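/- For a complex number $x$ and an integer $n\ge 0$ let $(x)_n=x(x+1)\cdots(x+n-1)$, with $(x)_0=1$, and for complex $k$ let $(x)_k=\Gamma(x+k)/\Gamma(x)$. Then for every complex number $k$ that is not a negative integer, $$\sum_{n=0}^{\infty}\left(\frac19\right)^n\frac{\left(\frac12\right)_n\left(\frac14+\frac{3k}{2}\right)_n\left(\frac34+\frac{3k}{2}\right)_n}{(1+k)_n^2\,(1)_n}\,(8n+6k+1)=\frac{2\sqrt3}{\pi}\cdot\frac{(1)_k^2}{\left(\frac16\right)_k\left(\frac56\right)_k},$$ where the series converges absolutely, and the right-hand side is read as $0$ when $\frac16+k$ or $\frac56+k$ is a non-positive integer (a pole of $\Gamma$). In particular ($k=0$), one has Ramanujan's series $$\sum_{n=0}^{\infty}\left(\frac19\right)^n\frac{\left(\frac12\right)_n\left(\frac14\right)_n\left(\frac34\right)_n}{(1)_n^3}\,(8n+1)=\frac{2\sqrt3}{\pi}.$$ -/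

import Mathlib

noncomputable section

/-- The rising factorial `(x)_n = x (x + 1) ⋯ (x + n - 1)` of a complex number `x`,
for a natural number `n`, with `(x)_0 = 1`. -/
def risingFactorial (x : ℂ) (n : ℕ) : ℂ :=
  ∏ i ∈ Finset.range n, (x + i)

/-- The rising factorial with a complex index, `(x)_k = Γ(x + k) / Γ(x)`.  It is used only where
`x` is not a pole of the Gamma function.  If `x + k` is a pole of the Gamma function then
`Complex.Gamma (x + k) = 0`, so that `1 / risingFactorialC x k = 0`, which is the value there of
the entire function `k ↦ Γ(x) / Γ(x + k)`. -/
def risingFactorialC (x k : ℂ) : ℂ :=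
  Complex.Gamma (x + k) / Complex.Gamma x

/-- For a natural number index the two definitions of the rising factorial agree. -/
theorem risingFactorialC_natCast (x : ℂ) (hx : ∀ m : ℕ, x ≠ -m) (n : ℕ) :
    risingFactorialC x n = risingFactorial x n := by
  have hG : Complex.Gamma x ≠ 0 := Complex.Gamma_ne_zero hx
  unfold risingFactorialC risingFactorial
  rw [div_eq_iff hG]
  induction n with
  | zero => simp
  | succ n ih =>
    have hne : x + n ≠ 0 := fun h => hx n (eq_neg_of_add_eq_zero_left h)
    rw [Finset.prod_range_succ, Nat.cast_succ, ← add_assoc, Complex.Gamma_add_one _ hne, ih]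
    ring

end

open Filter Topology Finset

/-! Wilf–Zeilberger method. A combination of the terms at `k` and `k + 1` is the difference of a
summable mate (`wz_zero`, `wz_succ`), so it sums to 0 and the sums satisfy S(k) =
(1/6+k)(5/6+k)/(1+k)² · S(k+1). Iterating N times leaves two limits. The product of the factors,
times k+N, tends to Γ(1+k)²/(Γ(1/6+k)Γ(5/6+k)) by Gauss's limit for Γ. By dominated convergence
S(k+N)/(k+N) tends to 6·∑ (1/4)ⁿ(1/2)ₙ/n! = 6(1-1/4)^(-1/2) = 12/√3. Reflection, Γ(1/6)Γ(5/6) = 2π,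
then gives the stated form. -/

theorem risingFactorial_zero (x : ℂ) : risingFactorial x 0 = 1 := by simp [risingFactorial]

theorem risingFactorial_succ (x : ℂ) (n : ℕ) :
    risingFactorial x (n + 1) = risingFactorial x n * (x + n) := by
  simp [risingFactorial, Finset.prod_range_succ]

theorem risingFactorial_succ' (x : ℂ) (n : ℕ) :
    risingFactorial x (n + 1) = x * risingFactorial (x + 1) n := by
  simp only [risingFactorial, Finset.prod_range_succ', Nat.cast_zero, add_zero, mul_comm x]
  congr 1
  exact Finset.prod_congr rfl fun i _ => by push_cast; ring

theorem risingFactorial_ne_zero {x : ℂ} (hx : ∀ m : ℕ, x + m ≠ 0) (n : ℕ) :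
    risingFactorial x n ≠ 0 :=
  Finset.prod_ne_zero_iff.2 fun i _ => hx i

theorem one_add_natCast_ne_zero (m : ℕ) : (1 : ℂ) + m ≠ 0 := by
  rw [add_comm]; exact Nat.cast_add_one_ne_zero m

/-! ### The WZ pair and the recurrence in `k` -/

/-- The general term of the extension of Ramanujan's series by the parameter `k`. -/
noncomputable def seriesTerm (k : ℂ) (n : ℕ) : ℂ :=
  (1 / 9 : ℂ) ^ n *
    (risingFactorial (1 / 2) n * risingFactorial (1 / 4 + 3 * k / 2) n *
        risingFactorial (3 / 4 + 3 * k / 2) n /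
      (risingFactorial (1 + k) n ^ 2 * risingFactorial 1 n)) *
    (8 * (n : ℂ) + 6 * k + 1)

/-- The Wilf–Zeilberger mate of `seriesTerm`, with the index shifted by one. -/
noncomputable def wzMate (k : ℂ) (n : ℕ) : ℂ :=
  (1 / 9 : ℂ) ^ n *
    (risingFactorial (1 / 2) n * risingFactorial (1 / 4 + 3 * k / 2) n *
        risingFactorial (7 / 4 + 3 * k / 2) n /
      (risingFactorial (1 + k) n ^ 2 * risingFactorial 1 n)) *
    ((2 * n + 1) ^ 2 * (1 / 4 + 3 * k / 2 + n) / (9 * (1 + k + n) ^ 2)) * (1 + k) ^ 2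

/-- The unshifted mate vanishes at index 0, so no term is subtracted here. -/
theorem wz_zero (k : ℂ) (hk : 1 + k ≠ 0) :
    (1 + k) ^ 2 * seriesTerm k 0 - (1 / 6 + k) * (5 / 6 + k) * seriesTerm (k + 1) 0 =
      wzMate k 0 := by
  simp only [seriesTerm, wzMate, risingFactorial_zero, Nat.cast_zero, add_zero, pow_zero]
  field_simp
  ring

theorem wz_succ (k : ℂ) (hk : ∀ m : ℕ, 1 + k + m ≠ 0) (n : ℕ) :
    (1 + k) ^ 2 * seriesTerm k (n + 1) -
        (1 / 6 + k) * (5 / 6 + k) * seriesTerm (k + 1) (n + 1) =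
      wzMate k (n + 1) - wzMate k n := by
  have hk0 : 1 + k ≠ 0 := by simpa using hk 0
  have hkn := hk n
  have hkn1 : 1 + k + (n + 1) ≠ 0 := by exact_mod_cast hk (n + 1)
  have hn : (1 : ℂ) + n ≠ 0 := one_add_natCast_ne_zero n
  have hP : risingFactorial (1 + k) n ≠ 0 := risingFactorial_ne_zero hk n
  have hF : risingFactorial 1 n ≠ 0 := risingFactorial_ne_zero one_add_natCast_ne_zero n
  have e1 : risingFactorial (1 + (k + 1)) (n + 1) =
      risingFactorial (1 + k) n * (1 + k + n) * (1 + k + (n + 1)) / (1 + k) := by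
    have h := risingFactorial_succ' (1 + k) (n + 1)
    rw [risingFactorial_succ, risingFactorial_succ, add_assoc 1 k 1] at h
    rw [eq_div_iff hk0, mul_comm, ← h]
    push_cast
    ring
  -- With b = 1/4 + 3k/2, (1/6+k)(5/6+k) = (4/9)·b(b+1) and the base on the left is b+2, so the
  -- prefactor is absorbed without dividing by a factor that may vanish.
  have e2 : (1 / 6 + k) * (5 / 6 + k) * risingFactorial (3 / 4 + 3 * (k + 1) / 2) (n + 1) =
      4 / 9 * (risingFactorial (1 / 4 + 3 * k / 2) n * (1 / 4 + 3 * k / 2 + n) *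
        (1 / 4 + 3 * k / 2 + n + 1) * (1 / 4 + 3 * k / 2 + n + 2)) := by
    have h := risingFactorial_succ' (1 / 4 + 3 * k / 2) (n + 2)
    rw [risingFactorial_succ' (1 / 4 + 3 * k / 2 + 1) (n + 1), risingFactorial_succ,
      risingFactorial_succ, risingFactorial_succ,
      show 1 / 4 + 3 * k / 2 + 1 + 1 = 3 / 4 + 3 * (k + 1) / 2 by ring] at h
    push_cast at h
    linear_combination (-4 / 9) * h
  have e3 : risingFactorial (1 / 4 + 3 * (k + 1) / 2) (n + 1) =
      risingFactorial (7 / 4 + 3 * k / 2) n * (7 / 4 + 3 * k / 2 + n) := by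
    rw [← risingFactorial_succ]; congr 1; ring
  have e4 : risingFactorial (3 / 4 + 3 * k / 2) (n + 1) =
      (3 / 4 + 3 * k / 2) * risingFactorial (7 / 4 + 3 * k / 2) n := by
    rw [risingFactorial_succ']; congr 2; ring
  have e5 : (1 / 6 + k) * (5 / 6 + k) * seriesTerm (k + 1) (n + 1) =
      (1 / 9 : ℂ) ^ (n + 1) * (risingFactorial (1 / 2) (n + 1) *
        risingFactorial (1 / 4 + 3 * (k + 1) / 2) (n + 1) *
        ((1 / 6 + k) * (5 / 6 + k) * risingFactorial (3 / 4 + 3 * (k + 1) / 2) (n + 1)) /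
      (risingFactorial (1 + (k + 1)) (n + 1) ^ 2 * risingFactorial 1 (n + 1))) *
      (8 * ((n + 1 : ℕ) : ℂ) + 6 * (k + 1) + 1) := by
    rw [seriesTerm]; ring
  rw [e5, e2, e1, e3]
  simp only [seriesTerm, wzMate, e4, risingFactorial_succ _ n]
  push_cast
  generalize risingFactorial (1 + k) n = P at *
  generalize risingFactorial 1 n = F at *
  generalize risingFactorial (1 / 2) n = A at *
  generalize risingFactorial (1 / 4 + 3 * k / 2) n = B at *
  generalize risingFactorial (7 / 4 + 3 * k / 2) n = C at *
  simp only [pow_succ (1 / 9 : ℂ) n]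
  generalize (1 / 9 : ℂ) ^ n = D at *
  generalize (n : ℂ) = x at *
  field_simp
  ring

theorem tendsto_add_div_add (a b : ℂ) :
    Tendsto (fun n : ℕ => (a + n) / (b + n)) atTop (𝓝 1) := by
  simpa using tendsto_add_mul_div_add_mul_atTop_nhds a b 1 (one_ne_zero (α := ℂ))

theorem summable_wzMate (k : ℂ) (hk : ∀ m : ℕ, 1 + k + m ≠ 0) : Summable (wzMate k) := by
  have hlim : Tendsto (fun n : ℕ => (1 / 9 : ℂ) * ((3 / 2 + n) / (1 + n)) * ((3 / 2 + n) / (1 / 2 + n)) *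
      ((1 / 4 + 3 * k / 2 + 1 + n) / (1 + k + 1 + n)) *
      ((7 / 4 + 3 * k / 2 + n) / (1 + k + 1 + n))) atTop (𝓝 (1 / 9)) := by
    simpa using ((((tendsto_add_div_add (3 / 2) 1).const_mul (1 / 9 : ℂ)).mul
      (tendsto_add_div_add _ _)).mul (tendsto_add_div_add _ _)).mul (tendsto_add_div_add _ _)
  -- Consecutive terms have ratio tending to 1/9; any bound strictly between 1/9 and 1 would do.
  refine summable_of_ratio_norm_eventually_le (r := 1 / 2) (by norm_num) ?_
  have hev := hlim.norm.eventually_le_const (show ‖(1 / 9 : ℂ)‖ < 1 / 2 by norm_num)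
  filter_upwards [hev] with n h
  refine le_trans (le_of_eq ?_) (mul_le_mul_of_nonneg_right h (norm_nonneg _))
  rw [← norm_mul]
  congr 1
  have hkn := hk n
  have hkn1 : 1 + k + (n + 1) ≠ 0 := by exact_mod_cast hk (n + 1)
  have hkn2 : 1 + k + 1 + n ≠ 0 := by convert hkn1 using 1; ring
  have hn : (1 : ℂ) + n ≠ 0 := one_add_natCast_ne_zero n
  have hn2 : (1 / 2 : ℂ) + n ≠ 0 := by
    intro h
    have := congrArg Complex.re h
    simp at this
    have h0 : (0 : ℝ) ≤ n := n.cast_nonneg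
    linarith
  have hP : risingFactorial (1 + k) n ≠ 0 := risingFactorial_ne_zero hk n
  have hF : risingFactorial 1 n ≠ 0 := risingFactorial_ne_zero one_add_natCast_ne_zero n
  have e1 : 1 + k + ((n : ℂ) + 1) = 1 + k + 1 + n := by ring
  simp only [wzMate, risingFactorial_succ _ n]
  push_cast
  rw [e1, pow_succ]
  generalize risingFactorial (1 + k) n = P at *
  generalize risingFactorial 1 n = F at *
  generalize risingFactorial (1 / 2) n = A at *
  generalize risingFactorial (1 / 4 + 3 * k / 2) n = B at *
  generalize risingFactorial (7 / 4 + 3 * k / 2) n = C at *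
  generalize (1 / 9 : ℂ) ^ n = D at *
  generalize (n : ℂ) = x at *
  have hn3 : (1 : ℂ) + 2 * x ≠ 0 := by
    intro h; exact hn2 (by linear_combination h / 2)
  field_simp
  ring

theorem hasSum_seriesTerm_of_add_one {k s : ℂ} (hk : ∀ m : ℕ, 1 + k + m ≠ 0)
    (hs : HasSum (seriesTerm (k + 1)) s) :
    HasSum (seriesTerm k) ((1 / 6 + k) * (5 / 6 + k) / (1 + k) ^ 2 * s) := by
  have hk0 : 1 + k ≠ 0 := by simpa using hk 0
  have hH := (summable_wzMate k hk).hasSum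
  set D : ℕ → ℂ := fun n =>
    (1 + k) ^ 2 * seriesTerm k n - (1 / 6 + k) * (5 / 6 + k) * seriesTerm (k + 1) n with hD
  -- The differences from index 1 on telescope to `-wzMate k 0`, which cancels `D 0`.
  have hD0 : HasSum D 0 := by
    have h1 := ((hasSum_nat_add_iff' 1).2 hH).sub hH
    have h2 := (hasSum_nat_add_iff (f := D) 1).1 (h1.congr_fun fun n => (wz_succ k hk n))
    have h3 : D 0 = wzMate k 0 := wz_zero k hk0
    simpa [h3] using h2
  have h := (hD0.add (hs.mul_left ((1 / 6 + k) * (5 / 6 + k)))).mul_left (((1 + k) ^ 2)⁻¹)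
  rw [show (1 / 6 + k) * (5 / 6 + k) / (1 + k) ^ 2 * s =
    ((1 + k) ^ 2)⁻¹ * (0 + (1 / 6 + k) * (5 / 6 + k) * s) by field_simp; ring]
  refine h.congr_fun fun n => ?_
  simp only [hD, sub_add_cancel]
  field_simp

theorem hasSum_seriesTerm_of_add_natCast {k : ℂ} (hk : ∀ m : ℕ, 1 + k + m ≠ 0) (N : ℕ) {s : ℂ}
    (hs : HasSum (seriesTerm (k + N)) s) :
    HasSum (seriesTerm k) (risingFactorial (1 / 6 + k) N * risingFactorial (5 / 6 + k) N /
      risingFactorial (1 + k) N ^ 2 * s) := by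
  induction N generalizing s with
  | zero => simpa [risingFactorial_zero] using hs
  | succ N ih =>
    have hkN : ∀ m : ℕ, 1 + (k + N) + m ≠ 0 := fun m => by
      have := hk (N + m); push_cast at this; convert this using 1; ring
    have h := ih (hasSum_seriesTerm_of_add_one hkN (by simpa [add_assoc] using hs))
    convert h using 1
    simp only [risingFactorial_succ, ← add_assoc, mul_pow, div_eq_mul_inv, mul_inv]
    ring

/-! ### Gauss's limit for the accumulated factors -/

/-- Holds at the poles too: there `GammaSeq` is eventually a division by zero, hence 0, and `Gamma`
also takes the value 0. -/
theorem tendsto_inv_GammaSeq (s : ℂ) :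
    Tendsto (fun n => (Complex.GammaSeq s n)⁻¹) atTop (𝓝 (Complex.Gamma s)⁻¹) := by
  by_cases h : ∃ m : ℕ, s = -m
  · obtain ⟨m, rfl⟩ := h
    refine tendsto_const_nhds.congr' ?_
    filter_upwards [eventually_ge_atTop m] with n hn
    have : ∏ j ∈ Finset.range (n + 1), (-(m : ℂ) + j) = 0 :=
      Finset.prod_eq_zero (Finset.mem_range.2 (Nat.lt_succ_of_le hn)) (by simp)
    simp [Complex.GammaSeq, this, Complex.Gamma_neg_nat_eq_zero]
  · exact (Complex.GammaSeq_tendsto_Gamma s).inv₀ (Complex.Gamma_ne_zero (not_exists.1 h))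

theorem tendsto_risingFactorial_ratio (k : ℂ) :
    Tendsto (fun N : ℕ => risingFactorial (1 / 6 + k) N * risingFactorial (5 / 6 + k) N /
        risingFactorial (1 + k) N ^ 2 * (k + N)) atTop
      (𝓝 (Complex.Gamma (1 + k) ^ 2 *
        ((Complex.Gamma (1 / 6 + k))⁻¹ * (Complex.Gamma (5 / 6 + k))⁻¹))) := by
  -- `GammaSeq s n` has `n + 1` factors in its denominator, so N = n + 1. The powers of n combine to
  -- n^(2(1+k) - (1+2k)) = n, which is compared with k + N.
  rw [← tendsto_add_atTop_iff_nat 1]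
  have h := ((((Complex.GammaSeq_tendsto_Gamma (1 + k)).pow 2).mul
    ((tendsto_inv_GammaSeq (1 / 6 + k)).mul (tendsto_inv_GammaSeq (5 / 6 + k))))).mul
      (tendsto_add_div_add (k + 1) 0)
  rw [mul_one] at h
  refine h.congr' ?_
  filter_upwards [eventually_ne_atTop 0] with n hn
  have hn' : (n : ℂ) ≠ 0 := Nat.cast_ne_zero.2 hn
  have hf : (n.factorial : ℂ) ≠ 0 := Nat.cast_ne_zero.2 n.factorial_ne_zero
  have e1 : (n : ℂ) ^ (1 / 6 + k) * (n : ℂ) ^ (5 / 6 + k) = (n : ℂ) ^ (1 + k + k) := by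
    rw [← Complex.cpow_add _ _ hn']; congr 1; ring
  have e2 : ((n : ℂ) ^ (1 + k)) ^ 2 = (n : ℂ) ^ (1 + k + k) * n := by
    rw [pow_two, ← Complex.cpow_add _ _ hn', show 1 + k + (1 + k) = 1 + k + k + 1 by ring,
      Complex.cpow_add _ _ hn', Complex.cpow_one]
  have hp : (n : ℂ) ^ (1 + k + k) ≠ 0 := by simp [Complex.cpow_eq_zero_iff, hn']
  change (_ * _ / risingFactorial (1 + k) (n + 1)) ^ 2 *
    ((_ * _ / risingFactorial (1 / 6 + k) (n + 1))⁻¹ *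
      (_ * _ / risingFactorial (5 / 6 + k) (n + 1))⁻¹) * _ = _
  simp only [inv_div, div_pow, mul_pow, e2]
  generalize risingFactorial (1 + k) (n + 1) = P
  generalize risingFactorial (1 / 6 + k) (n + 1) = Q
  generalize risingFactorial (5 / 6 + k) (n + 1) = R
  rw [div_mul_div_comm, show (n : ℂ) ^ (1 / 6 + k) * n.factorial * (n ^ (5 / 6 + k) * n.factorial) =
    (n : ℂ) ^ (1 + k + k) * n.factorial ^ 2 by rw [← e1]; ring]
  push_cast
  generalize (n : ℂ) ^ (1 + k + k) = X at *
  by_cases hP : P = 0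
  · simp [hP]
  rw [zero_add]
  field_simp
  ring

/-! ### A bound uniform in the shift -/

theorem norm_risingFactorial_le {x y : ℂ} {c : ℝ} (h : ∀ i : ℕ, ‖x + i‖ ≤ c * ‖y + i‖) (n : ℕ) :
    ‖risingFactorial x n‖ ≤ c ^ n * ‖risingFactorial y n‖ := by
  have e : c ^ n * ‖risingFactorial y n‖ = ∏ i ∈ Finset.range n, c * ‖y + i‖ := by
    rw [Finset.prod_mul_distrib, risingFactorial, norm_prod]; simp
  rw [e, risingFactorial, norm_prod]
  exact Finset.prod_le_prod (fun _ _ => norm_nonneg _) fun i _ => h i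

theorem norm_add_ofReal_le {z : ℂ} (hz : 0 ≤ z.re) {s t : ℝ} (hs : 0 ≤ s) (hst : s ≤ t) :
    ‖z + s‖ ≤ ‖z + t‖ := by
  rw [← pow_le_pow_iff_left₀ (norm_nonneg _) (norm_nonneg _) two_ne_zero, Complex.sq_norm,
    Complex.sq_norm, Complex.normSq_apply, Complex.normSq_apply]
  simp only [Complex.add_re, Complex.add_im, Complex.ofReal_re, Complex.ofReal_im, add_zero]
  nlinarith

theorem norm_add_three_halves_mul_le {k : ℂ} (hk : 0 ≤ k.re) {s : ℝ} (hs : 0 ≤ s)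
    (hs1 : s ≤ 3 / 2) (i : ℕ) :
    ‖(s : ℂ) + 3 * k / 2 + i‖ ≤ 3 / 2 * ‖1 + k + i‖ := by
  have h0 : (0 : ℝ) ≤ i := i.cast_nonneg
  have h := norm_add_ofReal_le (z := 3 * k / 2) (s := s + i) (t := 3 / 2 * (1 + i))
    (by rw [show 3 * k / 2 = ((3 / 2 : ℝ) : ℂ) * k by push_cast; ring, Complex.re_ofReal_mul]
        positivity) (by positivity) (by linarith)
  calc _ = ‖3 * k / 2 + ((s + i : ℝ) : ℂ)‖ := by congr 1; push_cast; ring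
    _ ≤ _ := h
    _ = ‖((3 / 2 : ℝ) : ℂ) * (1 + k + i)‖ := by congr 1; push_cast; ring
    _ = _ := by rw [norm_mul, Complex.norm_real]; norm_num

/-- Each of the two factors with 3k/2 costs (3/2)ⁿ against (1+k)ₙ, and 1/9 · 9/4 = 1/4. The bound is
linear in `‖k‖`, so dividing by k leaves a dominating series free of k. -/
theorem norm_seriesTerm_le {k : ℂ} (hk : 0 ≤ k.re) (hk1 : 1 ≤ ‖k‖) (n : ℕ) :
    ‖seriesTerm k n‖ ≤ (1 / 4 : ℝ) ^ n * (8 * n + 7) * ‖k‖ := by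
  have h1 := norm_risingFactorial_le (x := 1 / 2) (y := 1) (c := 1) (fun i => by
    have := norm_add_ofReal_le (z := (i : ℂ)) (s := 1 / 2) (t := 1) (by simp) (by norm_num)
      (by norm_num)
    push_cast at this
    rwa [one_mul, add_comm _ (i : ℂ), add_comm _ (i : ℂ)]) n
  have h2 := norm_risingFactorial_le (x := 1 / 4 + 3 * k / 2) (y := 1 + k) (c := 3 / 2) (fun i => by
    simpa using norm_add_three_halves_mul_le hk (s := 1 / 4) (by norm_num) (by norm_num) i) n
  have h3 := norm_risingFactorial_le (x := 3 / 4 + 3 * k / 2) (y := 1 + k) (c := 3 / 2) (fun i => by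
    simpa using norm_add_three_halves_mul_le hk (s := 3 / 4) (by norm_num) (by norm_num) i) n
  have h4 : ‖8 * (n : ℂ) + 6 * k + 1‖ ≤ (8 * n + 7) * ‖k‖ := by
    have : ‖8 * (n : ℂ) + 6 * k + 1‖ ≤ 8 * n + 6 * ‖k‖ + 1 := by
      refine (norm_add₃_le).trans (le_of_eq ?_)
      simp
    have h0 : (0 : ℝ) ≤ n := n.cast_nonneg
    nlinarith
  have hF : 0 < ‖risingFactorial 1 n‖ :=
    norm_pos_iff.2 (risingFactorial_ne_zero one_add_natCast_ne_zero n)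
  have hP : 0 < ‖risingFactorial (1 + k) n‖ :=
    norm_pos_iff.2 (risingFactorial_ne_zero (fun m h => by
      have h0 : (0 : ℝ) ≤ m := m.cast_nonneg
      have := congrArg Complex.re h
      simp at this
      linarith) n)
  have h5 : ‖risingFactorial (1 / 2) n‖ * ‖risingFactorial (1 / 4 + 3 * k / 2) n‖ *
      ‖risingFactorial (3 / 4 + 3 * k / 2) n‖ /
        (‖risingFactorial (1 + k) n‖ ^ 2 * ‖risingFactorial 1 n‖) ≤ (9 / 4 : ℝ) ^ n := by
    rw [div_le_iff₀ (by positivity)]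
    calc _ ≤ (1 ^ n * ‖risingFactorial 1 n‖) * ((3 / 2) ^ n * ‖risingFactorial (1 + k) n‖) *
          ((3 / 2) ^ n * ‖risingFactorial (1 + k) n‖) := by gcongr
      _ = _ := by
        rw [show (9 / 4 : ℝ) = 3 / 2 * (3 / 2) by norm_num, mul_pow]; ring
  calc ‖seriesTerm k n‖ = (1 / 9 : ℝ) ^ n * (‖risingFactorial (1 / 2) n‖ *
        ‖risingFactorial (1 / 4 + 3 * k / 2) n‖ * ‖risingFactorial (3 / 4 + 3 * k / 2) n‖ /
        (‖risingFactorial (1 + k) n‖ ^ 2 * ‖risingFactorial 1 n‖)) *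
        ‖8 * (n : ℂ) + 6 * k + 1‖ := by
        rw [seriesTerm]; simp only [norm_mul, norm_div, norm_pow]; norm_num
    _ ≤ (1 / 9 : ℝ) ^ n * (9 / 4 : ℝ) ^ n * ((8 * n + 7) * ‖k‖) := by gcongr
    _ = _ := by rw [← mul_pow]; norm_num; ring

theorem summable_bound : Summable fun n : ℕ => (1 / 4 : ℝ) ^ n * (8 * n + 7) := by
  have h1 := (summable_pow_mul_geometric_of_norm_lt_one 1 (r := (1 / 4 : ℝ))
    (by norm_num)).mul_left 8
  have h2 := (summable_geometric_of_lt_one (r := (1 / 4 : ℝ)) (by norm_num)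
    (by norm_num)).mul_left 7
  refine (h1.add h2).congr fun n => ?_
  ring

theorem eventually_re_nonneg_and_one_le_norm (k : ℂ) :
    ∀ᶠ N : ℕ in atTop, 0 ≤ (k + N).re ∧ 1 ≤ ‖k + N‖ := by
  filter_upwards [eventually_ge_atTop ⌈1 - k.re⌉₊] with N hN
  have h : 1 ≤ (k + N).re := by
    have := (Nat.le_ceil (1 - k.re)).trans (Nat.cast_le.2 hN)
    simp only [Complex.add_re, Complex.natCast_re]
    linarith
  exact ⟨by linarith, h.trans (Complex.re_le_norm _)⟩

/-! ### The limiting binomial series -/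

theorem tendsto_risingFactorial_div (k s : ℂ) (n : ℕ) :
    Tendsto (fun N : ℕ => risingFactorial (s + 3 * (k + N) / 2) n /
      risingFactorial (1 + (k + N)) n) atTop (𝓝 ((3 / 2) ^ n)) := by
  have h := tendsto_finsetProd (Finset.range n) fun (i : ℕ) _ =>
    tendsto_add_mul_div_add_mul_atTop_nhds (s + 3 * k / 2 + i) (1 + k + i) (3 / 2)
      (one_ne_zero (α := ℂ))
  simp only [Finset.prod_const, Finset.card_range, div_one] at h
  refine h.congr fun N => ?_
  rw [risingFactorial, risingFactorial, ← Finset.prod_div_distrib]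
  refine Finset.prod_congr rfl fun i _ => ?_
  congr 1 <;> ring

theorem tendsto_seriesTerm_div (k : ℂ) (n : ℕ) :
    Tendsto (fun N : ℕ => seriesTerm (k + N) n / (k + N)) atTop
      (𝓝 (6 * ((1 / 4) ^ n * (risingFactorial (1 / 2) n / risingFactorial 1 n)))) := by
  have h4 := tendsto_add_mul_div_add_mul_atTop_nhds (8 * n + 6 * k + 1) k 6
      (one_ne_zero (α := ℂ))
  have h := (((tendsto_risingFactorial_div k (1 / 4) n).mul
    (tendsto_risingFactorial_div k (3 / 4) n)).const_mul
      ((1 / 9 : ℂ) ^ n * (risingFactorial (1 / 2) n / risingFactorial 1 n))).mul h4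
  convert h using 1
  · ext N
    rw [seriesTerm, one_mul, show 8 * (n : ℂ) + 6 * (k + N) + 1 = 8 * n + 6 * k + 1 + 6 * N by ring]
    simp only [div_eq_mul_inv, mul_inv, pow_two]
    ring
  · rw [show (1 / 4 : ℂ) = 1 / 9 * (3 / 2 * (3 / 2)) by norm_num, mul_pow, mul_pow]
    congr 1
    ring

theorem choose_eq_risingFactorial_div (x : ℂ) (n : ℕ) :
    Ring.choose (x + n - 1) n = risingFactorial x n / risingFactorial 1 n := by
  have hr : ∀ m, risingFactorial x m = (ascPochhammer ℂ m).eval x := by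
    intro m
    induction m with
    | zero => simp [risingFactorial_zero]
    | succ m ih => rw [risingFactorial_succ, ascPochhammer_succ_eval, ih]
  have hf : risingFactorial 1 n = n.factorial := by
    induction n with
    | zero => simp [risingFactorial_zero]
    | succ m ih => rw [risingFactorial_succ, ih, Nat.factorial_succ]; push_cast; ring
  have h := Ring.factorial_nsmul_multichoose_eq_ascPochhammer x n
  rw [Polynomial.ascPochhammer_smeval_eq_eval, nsmul_eq_mul] at h
  rw [hr, hf, ← h, Ring.choose, show x + n - 1 - n + 1 = x by ring,
    mul_div_cancel_left₀ _ (Nat.cast_ne_zero.2 n.factorial_ne_zero)]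

theorem hasSum_inv_sqrt :
    HasSum (fun n : ℕ => (1 / 4 : ℂ) ^ n * (risingFactorial (1 / 2) n / risingFactorial 1 n))
      (2 / (Real.sqrt 3 : ℂ)) := by
  -- The binomial series of (1-x)^(-1/2) at x = 1/4.
  have h := (Complex.one_div_one_sub_cpow_hasFPowerSeriesOnBall_zero (1 / 2)).hasSum
    (y := 1 / 4) (by
      rw [← ENNReal.ofReal_one, Metric.eball_ofReal]
      simp
      norm_num)
  have e : (1 - (0 + 1 / 4) : ℂ) ^ (1 / 2 : ℂ) = ((Real.sqrt 3 / 2 : ℝ) : ℂ) := by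
    rw [show (1 - (0 + 1 / 4) : ℂ) = ((3 / 4 : ℝ) : ℂ) by push_cast; norm_num,
      show (1 / 2 : ℂ) = ((1 / 2 : ℝ) : ℂ) by push_cast; rfl,
      ← Complex.ofReal_cpow (by norm_num), ← Real.sqrt_eq_rpow, Real.sqrt_div (by norm_num),
      show (4 : ℝ) = 2 ^ 2 by norm_num, Real.sqrt_sq (by norm_num)]
  rw [e, Complex.ofReal_div, Complex.ofReal_ofNat, one_div_div] at h
  refine h.congr_fun fun n => ?_
  rw [FormalMultilinearSeries.ofScalars_apply_eq, choose_eq_risingFactorial_div, smul_eq_mul,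
    mul_comm]

/-! ### Passage to the limit and evaluation of the constant -/

theorem tendsto_tsum_seriesTerm_div (k : ℂ) :
    Tendsto (fun N : ℕ => (∑' n, seriesTerm (k + N) n) / (k + N)) atTop
      (𝓝 (6 * (2 / (Real.sqrt 3 : ℂ)))) := by
  rw [← hasSum_inv_sqrt.tsum_eq, ← tsum_mul_left]
  simp only [← tsum_div_const]
  refine tendsto_tsum_of_dominated_convergence summable_bound (tendsto_seriesTerm_div k) ?_
  filter_upwards [eventually_re_nonneg_and_one_le_norm k] with N hN n
  rw [norm_div, div_le_iff₀ (by linarith [hN.2])]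
  exact norm_seriesTerm_le hN.1 hN.2 n

theorem hasSum_seriesTerm {k : ℂ} (hk : ∀ m : ℕ, 1 + k + m ≠ 0) :
    HasSum (seriesTerm k) (Complex.Gamma (1 + k) ^ 2 *
      ((Complex.Gamma (1 / 6 + k))⁻¹ * (Complex.Gamma (5 / 6 + k))⁻¹) *
        (6 * (2 / (Real.sqrt 3 : ℂ)))) := by
  have hlim := (tendsto_risingFactorial_ratio k).mul (tendsto_tsum_seriesTerm_div k)
  have hev : ∀ᶠ N : ℕ in atTop, HasSum (seriesTerm k)
      (risingFactorial (1 / 6 + k) N * risingFactorial (5 / 6 + k) N /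
        risingFactorial (1 + k) N ^ 2 * (k + N) * ((∑' n, seriesTerm (k + N) n) / (k + N))) := by
    filter_upwards [eventually_re_nonneg_and_one_le_norm k] with N hN
    have hs : Summable (seriesTerm (k + N)) :=
      .of_norm_bounded (summable_bound.mul_right ‖k + N‖) (norm_seriesTerm_le hN.1 hN.2)
    have h0 : k + N ≠ 0 := norm_pos_iff.1 (by linarith [hN.2])
    convert hasSum_seriesTerm_of_add_natCast hk N hs.hasSum using 1
    field_simp
  obtain ⟨N, hN⟩ := hev.exists
  -- The iterated recurrence makes the product of the two sequences eventually constant, equal to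
  -- the sum at `k`.
  have : Tendsto (fun _ : ℕ => ∑' n, seriesTerm k n) atTop (𝓝 _) :=
    hlim.congr' (hev.mono fun _ h => h.tsum_eq.symm)
  rw [tendsto_nhds_unique this tendsto_const_nhds]
  exact hN.summable.hasSum

theorem Gamma_one_sixth_mul_Gamma_five_sixths :
    Complex.Gamma (1 / 6) * Complex.Gamma (5 / 6) = 2 * Real.pi := by
  have h := Complex.Gamma_mul_Gamma_one_sub (1 / 6)
  have hs : Complex.sin (Real.pi * (1 / 6)) = 1 / 2 := by
    rw [show (Real.pi : ℂ) * (1 / 6) = ((Real.pi / 6 : ℝ) : ℂ) by push_cast; ring,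
      ← Complex.ofReal_sin, Real.sin_pi_div_six]
    push_cast; rfl
  rw [hs, show (1 - 1 / 6 : ℂ) = 5 / 6 by norm_num] at h
  rw [h]; ring

theorem risingFactorialC_quotient_eq (k : ℂ) :
    2 * (Real.sqrt 3 : ℂ) / (Real.pi : ℂ) *
        (risingFactorialC 1 k ^ 2 / (risingFactorialC (1 / 6) k * risingFactorialC (5 / 6) k)) =
      Complex.Gamma (1 + k) ^ 2 *
        ((Complex.Gamma (1 / 6 + k))⁻¹ * (Complex.Gamma (5 / 6 + k))⁻¹) *
          (6 * (2 / (Real.sqrt 3 : ℂ))) := by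
  have hpi : (Real.pi : ℂ) ≠ 0 := by exact_mod_cast Real.pi_ne_zero
  have h3 : (Real.sqrt 3 : ℂ) ≠ 0 := by simp
  have h3' : (Real.sqrt 3 : ℂ) ^ 2 = 3 := by
    rw [← Complex.ofReal_pow, Real.sq_sqrt (by norm_num)]; norm_num
  simp only [risingFactorialC, Complex.Gamma_one, div_one]
  rw [div_mul_div_comm _ (Complex.Gamma (1 / 6)), Gamma_one_sixth_mul_Gamma_five_sixths, div_div_eq_mul_div _ _ (2 * (Real.pi : ℂ)),
    ← mul_inv]
  generalize Complex.Gamma (1 / 6 + k) * Complex.Gamma (5 / 6 + k) = X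
  rw [div_eq_mul_inv _ X]
  generalize X⁻¹ = Y
  field_simp
  rw [h3']; ring

theorem hasSum_seriesTerm_risingFactorialC {k : ℂ} (hk : ∀ m : ℕ, k ≠ -((m : ℂ) + 1)) :
    HasSum (seriesTerm k) (2 * (Real.sqrt 3 : ℂ) / (Real.pi : ℂ) *
      (risingFactorialC 1 k ^ 2 / (risingFactorialC (1 / 6) k * risingFactorialC (5 / 6) k))) := by
  rw [risingFactorialC_quotient_eq]
  exact hasSum_seriesTerm fun m h => hk m (by linear_combination h)

theorem mainTheorem12 :
    (∀ k : ℂ, (∀ m : ℕ, k ≠ -((m : ℂ) + 1)) →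
      HasSum
        (fun n : ℕ =>
          (1 / 9 : ℂ) ^ n *
            (risingFactorial (1 / 2) n * risingFactorial (1 / 4 + 3 * k / 2) n *
                risingFactorial (3 / 4 + 3 * k / 2) n /
              (risingFactorial (1 + k) n ^ 2 * risingFactorial 1 n)) *
            (8 * (n : ℂ) + 6 * k + 1))
        (2 * (Real.sqrt 3 : ℂ) / (Real.pi : ℂ) *
          (risingFactorialC 1 k ^ 2 /
            (risingFactorialC (1 / 6) k * risingFactorialC (5 / 6) k)))) ∧
    HasSum
      (fun n : ℕ =>
        (1 / 9 : ℂ) ^ n *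
          (risingFactorial (1 / 2) n * risingFactorial (1 / 4) n * risingFactorial (3 / 4) n /
            risingFactorial 1 n ^ 3) *
          (8 * (n : ℂ) + 1))
      (2 * (Real.sqrt 3 : ℂ) / (Real.pi : ℂ)) := by
  refine ⟨fun k hk => hasSum_seriesTerm_risingFactorialC hk, ?_⟩
  have h := hasSum_seriesTerm_risingFactorialC (k := 0) fun m h =>
    Nat.cast_add_one_ne_zero m (neg_eq_zero.1 h.symm)
  have h1 (x : ℂ) (hx : Complex.Gamma x ≠ 0) : risingFactorialC x 0 = 1 := by
    rw [risingFactorialC, add_zero, div_self hx]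
  rw [h1 1 (by simp), h1 _ (Complex.Gamma_ne_zero_of_re_pos (by norm_num)),
    h1 _ (Complex.Gamma_ne_zero_of_re_pos (by norm_num)), one_pow, mul_one, div_one, mul_one] at h
  refine h.congr_fun fun n => ?_
  simp only [seriesTerm, mul_zero, zero_div, add_zero, ← pow_succ]
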